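/- Let $p>1$, let $a<b$ be real, and put $F(s)=\frac1{2p}|s^2-1|^p$. For $\varepsilon>0$ and $u\in H^1(a,b)$ let $$E_\varepsilon[u]=\int_a^b\Big[\frac{\varepsilon^{p-1}|u_x|^p}{p}+\frac{F(u)}{\varepsilon}\Big]\,dx\in[0,\infty],$$ where $u_x$ is the weak derivative, and set $$c_p=\Big(\frac p{p-1}\Big)^{\frac{p-1}p}\int_{-1}^{1}F(s)^{\frac{p-1}p}\,ds,\qquad \lambda_p=2^{1-\frac1p}(p-1)^{-\frac1p}.$$ Let $N\in\mathbb N$ and let $v:[a,b]\to\{-1,1\}$ be a piecewise constant function whose jumps are located exactly at $N$ points $a<h_1<\dots<h_N<b$. Let $r>0$ satisfy $h_i+r<h_{i+1}-r$ for $i=1,\dots,N-1$, $a\le h_1-r$ and $h_N+r\le b$, and let $0<A<r\sqrt2\,\lambda_p$. Then there exist constants $\varepsilon_0,C,\delta>0$, depending only on $p$, $v$ and $A$, such that for every $u\in H^1(a,b)$ with $\|u-v\|_{L^1(a,b)}\le\delta$ and every $\varepsilon\in(0,\varepsilon_0)$, $$E_\varepsilon[u]\ \ge\ N c_p-C\exp\!\Big(-\frac{Ap}{2\varepsilon}\Big).$$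 -/

import Mathlib

open MeasureTheory Set Filter Topology
open scoped ContDiff ENNReal

noncomputable section

/-- The double-well potential `F(s) = |s² - 1|^p / (2p)` of the critical case `n = p`. -/
def potential (p s : ℝ) : ℝ := 1 / (2 * p) * |s ^ 2 - 1| ^ p

/-- The minimal transition energy
`c_p = (p/(p-1))^((p-1)/p) ∫_{-1}^{1} F(s)^((p-1)/p) ds`. -/
def transitionEnergy (p : ℝ) : ℝ :=
  (p / (p - 1)) ^ ((p - 1) / p) * ∫ s in (-1 : ℝ)..1, potential p s ^ ((p - 1) / p)

/-- The rate `λ_p = 2^(1 - 1/p) (p-1)^(-1/p)`. -/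
def decayRate (p : ℝ) : ℝ := 2 ^ (1 - 1 / p) * (p - 1) ^ (-(1 / p))

/-- `v : [a,b] → {-1,1}` is piecewise constant, with jumps located exactly at
`a < h 0 < h 1 < ⋯ < h (N-1) < b`. The values of `v` outside `[a,b]` play no role. -/
structure IsJumpFunction (a b : ℝ) {N : ℕ} (h : Fin N → ℝ) (v : ℝ → ℝ) : Prop where
  strictMono : StrictMono h
  mem_Ioo : ∀ i, h i ∈ Ioo a b
  values : ∀ x ∈ Icc a b, v x = -1 ∨ v x = 1
  /-- `v` is constant on every subinterval of `[a,b]` that contains none of the jump points. -/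
  const : ∀ x ∈ Icc a b, ∀ y ∈ Icc a b, x ≤ y → (∀ i, h i ∉ Icc x y) → v x = v y
  /-- `v` takes opposite values immediately to the left and to the right of each `h i`. -/
  jump : ∀ i, ∃ s : ℝ, (∀ᶠ x in 𝓝[<] (h i), v x = -s) ∧ (∀ᶠ x in 𝓝[>] (h i), v x = s)

/-- `g` is a weak derivative of `u` on the interval `(a,b)`: integration by parts against every
test function `φ ∈ C_c^∞(a,b)`. (It is used for `u` and `g` in `L²(a,b)` only, so that both
integrals converge.) -/
def IsWeakDeriv (a b : ℝ) (u g : ℝ → ℝ) : Prop :=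
  ∀ φ : ℝ → ℝ, ContDiff ℝ ∞ φ → HasCompactSupport φ → tsupport φ ⊆ Ioo a b →
    ∫ x in Ioo a b, u x * deriv φ x = -∫ x in Ioo a b, g x * φ x

/-- `u` belongs to the Sobolev space `H¹(a,b)`, and `g` is its (almost everywhere unique) weak
derivative `u_x`. -/
structure MemH1 (a b : ℝ) (u g : ℝ → ℝ) : Prop where
  memLp : MemLp u 2 (volume.restrict (Ioo a b))
  memLp_deriv : MemLp g 2 (volume.restrict (Ioo a b))
  isWeakDeriv : IsWeakDeriv a b u g

/-- The renormalized energy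
`E_ε[u] = ∫_a^b [ε^(p-1) |u_x|^p / p + F(u) / ε] dx` of a function `u` with weak derivative
`u_x = g`. The integrand is nonnegative, and the value is `∞` where the integral diverges (this
happens for some `u ∈ H¹` when `p > 2`). -/
def energy (p ε a b : ℝ) (u g : ℝ → ℝ) : ℝ≥0∞ :=
  ∫⁻ x in Ioo a b, ENNReal.ofReal (ε ^ (p - 1) * |g x| ^ p / p + potential p (u x) / ε)

end

/-!
The proof is by calibration. Let `Φ` be the primitive of `(p/(p-1) · F)^((p-1)/p)` vanishing at `0`
(`transitionCost`), so that `c_p = Φ(1) - Φ(-1)`. Young's inequality bounds the energy on any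
interval from below by the variation of `Φ(u)`. More generally, if a weight `k` with values in
`[0,1]` satisfies `ε |k'| |Φ(u) - Φ(τ)| ≤ (1 - k^q) F(u)` with `q = p/(p-1)`, then the energy bounds
the change of `k · (Φ(u) - Φ(τ))` (`ofReal_abs_sub_le_energy`).

Near a well `τ = ±1` the potential dominates `κ |Φ - Φ(τ)|` for every `κ < λ_p (p - 1)`: indeed
`F' = ± s |s² - 1|^(p-1)` is proportional to `s Φ'`
(`exists_mul_abs_transitionCost_sub_le_potential`). Hence `k = 1 - e` is admissible as soon as
`ε |e'| ≤ κ (1 - (1 - e)^q)`, whose right-hand side is about `q κ e` for small `e`. So `e` may grow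
exponentially towards the end of the interval, at any rate below `q κ / ε` while it is small, and
then at the rate `κ / ε` until `e = 1`, which takes a length of order `ε` only. With `k = 0` at that
end no boundary condition is needed there, and at the start `1 - k` is exponentially small: the
energy between a point `x` where `u` is near `τ` and a point at distance `d` is at least
`(1 - K exp(-ν d / ε)) |Φ(u(x)) - Φ(τ)|`, for every `ν < p λ_p`
(`exists_ofReal_mul_abs_le_energy`).

`L¹` closeness to `v` provides points close to each `h i`, on either side, at which `u` is near the
two wells. Adding the bounds for the two outer intervals and for the inner one, the triangle
inequality gives `(1 - K exp(…)) c_p` for each layer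
(`exists_ofReal_mul_transitionEnergy_le_energy`), and the layers are disjoint.

All this takes place for an absolutely continuous representative of `u`, which the du Bois-Reymond
lemma provides (`MemH1.exists_ae_eq_primitive`).
-/

/-! ### Sobolev functions on an interval are primitives -/

/-- A test function on `(a,b)` with vanishing integral is the derivative of a test function
on `(a,b)`. -/
theorem exists_testFunction_deriv_eq {a b : ℝ} (hab : a < b) {η : ℝ → ℝ} (hη : ContDiff ℝ ∞ η)
    (hηc : HasCompactSupport η) (hηs : tsupport η ⊆ Ioo a b) (hη0 : ∫ x, η x = 0) :
    ∃ φ : ℝ → ℝ, ContDiff ℝ ∞ φ ∧ HasCompactSupport φ ∧ tsupport φ ⊆ Ioo a b ∧ deriv φ = η := by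
  -- adding the midpoint makes the compact set nonempty, so that it has a least and a greatest point
  obtain ⟨c, d, hac, hdb, hcd⟩ : ∃ c d, a < c ∧ d < b ∧ tsupport η ⊆ Icc c d := by
    have hK : IsCompact (insert ((a + b) / 2) (tsupport η)) := hηc.isCompact.insert _
    have hne : (insert ((a + b) / 2) (tsupport η)).Nonempty := insert_nonempty _ _
    have hsub : insert ((a + b) / 2) (tsupport η) ⊆ Ioo a b :=
      insert_subset ⟨by linarith, by linarith⟩ hηs
    obtain ⟨c, hc⟩ := hK.exists_isLeast hne
    obtain ⟨d, hd⟩ := hK.exists_isGreatest hne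
    exact ⟨c, d, (hsub hc.1).1, (hsub hd.1).2, fun x hx =>
      ⟨hc.2 (mem_insert_of_mem _ hx), hd.2 (mem_insert_of_mem _ hx)⟩⟩
  have hzero : ∀ x, x ∉ Icc c d → η x = 0 := fun x hx => image_eq_zero_of_notMem_tsupport
    fun h => hx (hcd h)
  have hderiv : ∀ x, HasDerivAt (fun x => ∫ t in a..x, η t) (η x) x := fun x =>
    hη.continuous.integral_hasStrictDerivAt a x |>.hasDerivAt
  have hdeq : deriv (fun x => ∫ t in a..x, η t) = η := funext fun x => (hderiv x).deriv
  have hsupp : tsupport (fun x => ∫ t in a..x, η t) ⊆ Icc c d := by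
    refine closure_minimal ?_ isClosed_Icc
    intro x hx
    by_contra hxI
    apply hx
    rcases lt_or_ge x c with hxc | hxc
    · apply intervalIntegral.integral_zero_ae
      refine Eventually.of_forall fun t ht => hzero t fun htI => ?_
      rcases mem_uIoc.1 ht with ⟨_, h2⟩ | ⟨_, h2⟩ <;> linarith [htI.1]
    · have hdx : d < x := not_le.1 fun h => hxI ⟨hxc, h⟩
      refine (intervalIntegral.integral_eq_integral_of_support_subset ?_).trans hη0
      intro t ht
      have := hcd (subset_tsupport _ ht)
      exact ⟨hac.trans_le this.1, this.2.trans hdx.le⟩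
  refine ⟨fun x => ∫ t in a..x, η t, ?_, ?_, ?_, hdeq⟩
  · exact contDiff_infty_iff_deriv.2 ⟨fun x => (hderiv x).differentiableAt, by rwa [hdeq]⟩
  · exact isCompact_Icc.of_isClosed_subset (isClosed_tsupport _) hsupp
  · exact hsupp.trans fun x hx => ⟨hac.trans_le hx.1, hx.2.trans_lt hdb⟩

/-- The du Bois-Reymond lemma: a function with vanishing weak derivative is constant. -/
theorem ae_eq_const_of_isWeakDeriv_zero {a b : ℝ} (hab : a < b) {w : ℝ → ℝ}
    (hw : IntegrableOn w (Ioo a b)) (h : IsWeakDeriv a b w 0) :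
    ∃ c, ∀ᵐ x ∂volume.restrict (Ioo a b), w x = c := by
  have hprod : ∀ φ : ℝ → ℝ, Continuous φ → HasCompactSupport φ →
      IntegrableOn (fun x => w x * φ x) (Ioo a b) := by
    intro φ hφ hφc
    obtain ⟨C, hC⟩ := hφc.exists_bound_of_continuous hφ
    exact hw.mul_bdd hφ.aestronglyMeasurable (Eventually.of_forall hC)
  let θ : ContDiffBump ((a + b) / 2) := ⟨(b - a) / 8, (b - a) / 4, by linarith, by linarith⟩
  let Θ : ℝ → ℝ := θ.normed volume
  have hΘ : ContDiff ℝ ∞ Θ := θ.contDiff_normed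
  have hΘc : HasCompactSupport Θ := θ.hasCompactSupport_normed
  have hΘs : tsupport Θ ⊆ Ioo a b := by
    intro x hx
    have hx : x ∈ Metric.closedBall ((a + b) / 2) ((b - a) / 4) := by
      have := θ.tsupport_normed_eq (μ := volume)
      rwa [← this]
    rw [Real.closedBall_eq_Icc] at hx
    exact ⟨by linarith [hx.1], by linarith [hx.2]⟩
  have hΘ1 : ∫ x, Θ x = 1 := θ.integral_normed
  refine ⟨∫ x in Ioo a b, w x * Θ x, ?_⟩
  set c := ∫ x in Ioo a b, w x * Θ x with hc
  rw [ae_restrict_iff' measurableSet_Ioo]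
  have hloc : LocallyIntegrableOn (fun x => w x - c) (Ioo a b) :=
    (hw.sub (integrableOn_const (by simp))).locallyIntegrableOn
  have key := isOpen_Ioo.ae_eq_zero_of_integral_contDiff_smul_eq_zero hloc (by
    intro ψ hψ hψc hψs
    -- `ψ - (∫ ψ) Θ` has vanishing integral, hence is the derivative of a test function
    set m := ∫ x, ψ x with hm
    have hη : ContDiff ℝ ∞ (fun x => ψ x - m * Θ x) := hψ.sub (contDiff_const.mul hΘ)
    have hΘm : HasCompactSupport (fun x => m * Θ x) := hΘc.mul_left
    have hts : tsupport (fun x => ψ x - m * Θ x) ⊆ tsupport ψ ∪ tsupport Θ := by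
      refine closure_minimal ?_ ((isClosed_tsupport _).union (isClosed_tsupport _))
      intro x hx
      by_contra hcon
      rw [mem_union, not_or] at hcon
      apply hx
      simp [image_eq_zero_of_notMem_tsupport hcon.1, image_eq_zero_of_notMem_tsupport hcon.2]
    have hηc : HasCompactSupport (fun x => ψ x - m * Θ x) := hψc.sub hΘm
    have hψi : Integrable ψ := hψ.continuous.integrable_of_hasCompactSupport hψc
    have hΘi : Integrable Θ := hΘ.continuous.integrable_of_hasCompactSupport hΘc
    have hη0 : ∫ x, (ψ x - m * Θ x) = 0 := by
      rw [integral_sub hψi (hΘi.const_mul m), integral_const_mul, hΘ1]; simp [hm]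
    obtain ⟨φ, hφ, hφc, hφs, hφd⟩ := exists_testFunction_deriv_eq hab hη hηc
      (hts.trans (union_subset hψs hΘs)) hη0
    have h1 := h φ hφ hφc hφs
    simp only [hφd, Pi.zero_apply, zero_mul, integral_zero, neg_zero] at h1
    have h2 : ∫ x in Ioo a b, w x * (ψ x - m * Θ x)
        = (∫ x in Ioo a b, w x * ψ x) - m * c := by
      rw [hc, ← integral_const_mul, ← integral_sub (hprod ψ hψ.continuous hψc)
        ((hprod Θ hΘ.continuous hΘc).const_mul m)]
      congr 1; ext x; ring
    have h3 : ∫ x, ψ x • (w x - c) = ∫ x in Ioo a b, ψ x • (w x - c) := by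
      symm
      apply setIntegral_eq_integral_of_forall_compl_eq_zero
      intro x hx
      rw [image_eq_zero_of_notMem_tsupport fun h => hx (hψs h), zero_smul]
    have h4 : m = ∫ x in Ioo a b, ψ x := by
      symm
      apply setIntegral_eq_integral_of_forall_compl_eq_zero
      intro x hx
      rw [image_eq_zero_of_notMem_tsupport fun h => hx (hψs h)]
    have h5 : ∫ x in Ioo a b, ψ x • (w x - c) = (∫ x in Ioo a b, w x * ψ x) - m * c := by
      rw [h4, mul_comm, ← integral_const_mul, ← integral_sub (hprod ψ hψ.continuous hψc)
        (hψi.integrableOn.const_mul c)]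
      congr 1; ext x; simp only [smul_eq_mul]; ring
    rw [h3, h5, ← h2, h1])
  filter_upwards [key] with x hx hxI
  linarith [hx hxI]

theorem MemH1.integrableOn_deriv {a b : ℝ} {u g : ℝ → ℝ} (h : MemH1 a b u g) :
    IntegrableOn g (Ioo a b) :=
  h.memLp_deriv.integrable (by norm_num)

theorem MemH1.intervalIntegrable_deriv {a b : ℝ} (hab : a < b) {u g : ℝ → ℝ}
    (h : MemH1 a b u g) : IntervalIntegrable g volume a b := by
  rw [intervalIntegrable_iff_integrableOn_Ioo_of_le hab.le]
  exact h.integrableOn_deriv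

/-- A function in `H¹(a,b)` agrees almost everywhere with a primitive of its weak derivative. -/
theorem MemH1.exists_ae_eq_primitive {a b : ℝ} (hab : a < b) {u g : ℝ → ℝ} (h : MemH1 a b u g) :
    ∃ c, ∀ᵐ x ∂volume.restrict (Ioo a b), u x = c + ∫ t in a..x, g t := by
  have hg := h.intervalIntegrable_deriv hab
  set U : ℝ → ℝ := fun x => ∫ t in a..x, g t with hU
  have hUac : AbsolutelyContinuousOnInterval U a b :=
    hg.absolutelyContinuousOnInterval_intervalIntegral left_mem_uIcc
  have hUcont : ContinuousOn U (Icc a b) := by simpa [uIcc_of_le hab.le] using hUac.continuousOn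
  have hUint : IntegrableOn U (Ioo a b) :=
    (hUcont.integrableOn_compact isCompact_Icc).mono_set Ioo_subset_Icc_self
  have huint : IntegrableOn u (Ioo a b) := h.memLp.integrable (by norm_num)
  have hweak : IsWeakDeriv a b (fun x => u x - U x) 0 := by
    intro φ hφ hφc hφs
    have hφa : φ a = 0 := image_eq_zero_of_notMem_tsupport fun h => (hφs h).1.false
    have hφb : φ b = 0 := image_eq_zero_of_notMem_tsupport fun h => (hφs h).2.false
    have hφ' : Continuous (deriv φ) := hφ.continuous_deriv (by simp)
    obtain ⟨C, hC⟩ := hφc.deriv.exists_bound_of_continuous hφ'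
    have hφac : AbsolutelyContinuousOnInterval φ a b :=
      (hφ.of_le (by simp)).contDiffOn.absolutelyContinuousOnInterval
    have h1 := hUac.integral_mul_deriv_eq_deriv_mul hφac
    rw [hφa, hφb, mul_zero, mul_zero, sub_zero, zero_sub] at h1
    have h2 : ∫ x in a..b, deriv U x * φ x = ∫ x in a..b, g x * φ x := by
      apply intervalIntegral.integral_congr_ae
      filter_upwards [hg.ae_hasDerivAt_integral] with x hx hxI
      rw [(hx (uIoc_subset_uIcc hxI) a left_mem_uIcc).deriv]
    rw [h2, intervalIntegral.integral_of_le hab.le, intervalIntegral.integral_of_le hab.le,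
      integral_Ioc_eq_integral_Ioo, integral_Ioc_eq_integral_Ioo] at h1
    have h3 : ∫ x in Ioo a b, (u x - U x) * deriv φ x
        = (∫ x in Ioo a b, u x * deriv φ x) - ∫ x in Ioo a b, U x * deriv φ x := by
      rw [← integral_sub (huint.mul_bdd hφ'.aestronglyMeasurable (Eventually.of_forall hC))
        (hUint.mul_bdd hφ'.aestronglyMeasurable (Eventually.of_forall hC))]
      congr 1; ext x; ring
    rw [h3, h1, h.isWeakDeriv φ hφ hφc hφs]
    simp
  obtain ⟨c, hc⟩ := ae_eq_const_of_isWeakDeriv_zero hab (huint.sub hUint) hweak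
  refine ⟨c, ?_⟩
  filter_upwards [hc] with x hx
  rw [Pi.sub_apply] at hx
  linarith

/-! ### The transition cost and the calibration inequality -/

theorem potential_nonneg {p : ℝ} (hp : 1 < p) (s : ℝ) : 0 ≤ potential p s := by
  unfold potential; positivity

theorem continuous_potential {p : ℝ} (hp : 1 < p) : Continuous (potential p) := by
  unfold potential
  exact continuous_const.mul ((by fun_prop : Continuous fun s : ℝ => |s ^ 2 - 1|).rpow_const
    fun _ => Or.inr (by linarith))

/-- The energy per unit of variation of `u` at the level `s`: the quantity
`(p/(p-1) · F(s))^((p-1)/p)` that Young's inequality produces. -/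
noncomputable def transitionDensity (p s : ℝ) : ℝ :=
  (p / (p - 1)) ^ ((p - 1) / p) * potential p s ^ ((p - 1) / p)

/-- The transition cost `Φ`, the primitive of `transitionDensity` vanishing at `0`. The least energy
of a transition from `s` to `t` is `|Φ t - Φ s|`. -/
noncomputable def transitionCost (p s : ℝ) : ℝ := ∫ t in (0 : ℝ)..s, transitionDensity p t

theorem continuous_transitionDensity {p : ℝ} (hp : 1 < p) : Continuous (transitionDensity p) := by
  unfold transitionDensity
  have : 0 ≤ (p - 1) / p := div_nonneg (by linarith) (by linarith)
  exact continuous_const.mul ((continuous_potential hp).rpow_const fun _ => Or.inr this)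

theorem transitionDensity_nonneg {p : ℝ} (hp : 1 < p) (s : ℝ) : 0 ≤ transitionDensity p s := by
  unfold transitionDensity
  have h1 : 0 ≤ p / (p - 1) := div_nonneg (by linarith) (by linarith)
  exact mul_nonneg (Real.rpow_nonneg h1 _) (Real.rpow_nonneg (potential_nonneg hp s) _)

theorem hasDerivAt_transitionCost {p : ℝ} (hp : 1 < p) (s : ℝ) :
    HasDerivAt (transitionCost p) (transitionDensity p s) s :=
  ((continuous_transitionDensity hp).integral_hasStrictDerivAt 0 s).hasDerivAt

theorem contDiff_transitionCost {p : ℝ} (hp : 1 < p) : ContDiff ℝ 1 (transitionCost p) := by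
  rw [contDiff_one_iff_deriv]
  refine ⟨fun s => (hasDerivAt_transitionCost hp s).differentiableAt, ?_⟩
  rw [funext fun s => (hasDerivAt_transitionCost hp s).deriv]
  exact continuous_transitionDensity hp

theorem transitionCost_sub {p : ℝ} (hp : 1 < p) (s t : ℝ) :
    transitionCost p t - transitionCost p s = ∫ x in s..t, transitionDensity p x := by
  unfold transitionCost
  exact intervalIntegral.integral_interval_sub_left
    ((continuous_transitionDensity hp).intervalIntegrable _ _)
    ((continuous_transitionDensity hp).intervalIntegrable _ _)

theorem transitionEnergy_eq {p : ℝ} (hp : 1 < p) :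
    transitionEnergy p = transitionCost p 1 - transitionCost p (-1) := by
  rw [transitionCost_sub hp]
  unfold transitionEnergy transitionDensity
  rw [intervalIntegral.integral_const_mul]

theorem transitionEnergy_nonneg {p : ℝ} (hp : 1 < p) : 0 ≤ transitionEnergy p := by
  rw [transitionEnergy_eq hp, transitionCost_sub hp]
  exact intervalIntegral.integral_nonneg (by norm_num) fun s _ => transitionDensity_nonneg hp s

/-- Young's inequality with a weight `k`: only the share `k ^ (p/(p-1))` of the potential
energy is spent. -/
theorem mul_transitionDensity_mul_abs_le {p ε k : ℝ} (hp : 1 < p) (hε : 0 < ε) (hk : 0 ≤ k)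
    (s ξ : ℝ) :
    k * transitionDensity p s * |ξ|
      ≤ ε ^ (p - 1) * |ξ| ^ p / p + k ^ (p / (p - 1)) * (potential p s / ε) := by
  have hp0 : 0 < p := by linarith
  have hp1 : 0 < p - 1 := by linarith
  have hF := potential_nonneg hp s
  have hconj : p.HolderConjugate (p / (p - 1)) := Real.HolderConjugate.conjExponent hp
  have hy := Real.young_inequality_of_nonneg
    (a := ε ^ ((p - 1) / p) * |ξ|)
    (b := k * ((p / (p - 1)) * potential p s / ε) ^ ((p - 1) / p))
    (by positivity) (by positivity) hconj
  have e1 : (ε ^ ((p - 1) / p) * |ξ|) ^ p = ε ^ (p - 1) * |ξ| ^ p := by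
    rw [Real.mul_rpow (by positivity) (abs_nonneg _), ← Real.rpow_mul hε.le]
    congr 2; field_simp
  have e2 : (k * ((p / (p - 1)) * potential p s / ε) ^ ((p - 1) / p)) ^ (p / (p - 1))
      = k ^ (p / (p - 1)) * ((p / (p - 1)) * potential p s / ε) := by
    rw [Real.mul_rpow hk (by positivity), ← Real.rpow_mul (by positivity)]
    congr 1
    rw [show (p - 1) / p * (p / (p - 1)) = 1 by field_simp, Real.rpow_one]
  have e3 : ε ^ ((p - 1) / p) * |ξ| * (k * ((p / (p - 1)) * potential p s / ε) ^ ((p - 1) / p))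
      = k * transitionDensity p s * |ξ| := by
    unfold transitionDensity
    rw [Real.div_rpow (by positivity) hε.le, Real.mul_rpow (by positivity) hF]
    have : ε ^ ((p - 1) / p) ≠ 0 := (Real.rpow_pos_of_pos hε _).ne'
    field_simp
  rw [e1, e2, e3] at hy
  refine hy.trans (le_of_eq ?_)
  congr 1
  field_simp

/-- Composition with a `C¹` function preserves absolute continuity. -/
theorem AbsolutelyContinuousOnInterval.contDiff_comp {f U : ℝ → ℝ} {α β : ℝ} (hf : ContDiff ℝ 1 f)
    (hU : AbsolutelyContinuousOnInterval U α β) :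
    AbsolutelyContinuousOnInterval (fun x => f (U x)) α β := by
  obtain ⟨C, hC⟩ := hU.exists_bound
  obtain ⟨K, hK⟩ := hf.contDiffOn.exists_lipschitzOnWith (by decide) (convex_Icc (-C) C)
    isCompact_Icc
  have hmem : ∀ x ∈ uIcc α β, U x ∈ Icc (-C) C := fun x hx => abs_le.1 (hC x hx)
  rw [absolutelyContinuousOnInterval_iff] at hU ⊢
  intro e he
  obtain ⟨d, hd, h⟩ := hU (e / (K + 1)) (by positivity)
  refine ⟨d, hd, fun E hE hEd => ?_⟩
  have h1 := h E hE hEd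
  rw [lt_div_iff₀ (by positivity)] at h1
  have h2 : ∑ i ∈ Finset.range E.1, dist (f (U (E.2 i).1)) (f (U (E.2 i).2))
      ≤ K * ∑ i ∈ Finset.range E.1, dist (U (E.2 i).1) (U (E.2 i).2) := by
    rw [Finset.mul_sum]
    refine Finset.sum_le_sum fun i hi => ?_
    have := hE.1 i hi
    exact hK.dist_le_mul _ (hmem _ this.1) _ (hmem _ this.2)
  have h3 : 0 ≤ ∑ i ∈ Finset.range E.1, dist (U (E.2 i).1) (U (E.2 i).2) :=
    Finset.sum_nonneg fun _ _ => dist_nonneg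
  nlinarith

/-- The calibration inequality. If the weight `k` varies so slowly that the share `1 - k^(p/(p-1))`
of the potential energy pays for the change of `k · (Φ(U) - c)` caused by `k`, then the energy
controls the total change of `k · (Φ(U) - c)`. -/
theorem ofReal_abs_sub_le_energy {p ε α β c : ℝ} (hp : 1 < p) (hε : 0 < ε) (hαβ : α ≤ β)
    {U : ℝ → ℝ} (hU : AbsolutelyContinuousOnInterval U α β) {k : ℝ → ℝ} (hk : ContDiff ℝ 1 k)
    (hk0 : ∀ x ∈ Icc α β, 0 ≤ k x)
    (hkd : ∀ x ∈ Icc α β, ε * (|deriv k x| * |transitionCost p (U x) - c|)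
      ≤ (1 - k x ^ (p / (p - 1))) * potential p (U x)) :
    ENNReal.ofReal |k β * (transitionCost p (U β) - c) - k α * (transitionCost p (U α) - c)|
      ≤ energy p ε α β U (deriv U) := by
  set W : ℝ → ℝ := fun x => k x * (transitionCost p (U x) - c) with hW
  have hWac : AbsolutelyContinuousOnInterval W α β := by
    have h1 := AbsolutelyContinuousOnInterval.contDiff_comp
      ((contDiff_transitionCost hp).sub (contDiff_const (c := c))) hU
    exact (hk.contDiffOn.absolutelyContinuousOnInterval).fun_mul h1
  have h0 : W β - W α = ∫ x in Ioo α β, deriv W x := by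
    rw [← hWac.integral_deriv_eq_sub, intervalIntegral.integral_of_le hαβ,
      integral_Ioc_eq_integral_Ioo]
  change ENNReal.ofReal |W β - W α| ≤ _
  rw [← Real.norm_eq_abs, ofReal_norm, h0]
  refine (enorm_integral_le_lintegral_enorm _).trans ?_
  unfold energy
  refine lintegral_mono_ae ?_
  rw [ae_restrict_iff' measurableSet_Ioo]
  filter_upwards [hU.ae_differentiableAt] with x hx hxI
  have hxI' : x ∈ Icc α β := Ioo_subset_Icc_self hxI
  have hUx := (hx (by rwa [uIcc_of_le hαβ])).hasDerivAt
  have hkx := (hk.differentiable (by norm_num) x).hasDerivAt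
  have hWx : HasDerivAt W (deriv k x * (transitionCost p (U x) - c)
      + k x * (transitionDensity p (U x) * deriv U x)) x :=
    hkx.mul (((hasDerivAt_transitionCost hp (U x)).comp x hUx).sub_const c)
  rw [hWx.deriv, ← ofReal_norm, Real.norm_eq_abs]
  refine ENNReal.ofReal_le_ofReal ((abs_add_le _ _).trans ?_)
  rw [abs_mul, abs_mul, abs_mul, abs_of_nonneg (hk0 x hxI'),
    abs_of_nonneg (transitionDensity_nonneg hp _)]
  have h1 := mul_transitionDensity_mul_abs_le hp hε (hk0 x hxI') (U x) (deriv U x)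
  have h2 : |deriv k x| * |transitionCost p (U x) - c|
      ≤ (1 - k x ^ (p / (p - 1))) * (potential p (U x) / ε) := by
    rw [← mul_div_assoc, le_div_iff₀ hε]
    linarith [hkd x hxI']
  linarith

/-- The energy of a transition is at least its cost. -/
theorem ofReal_abs_transitionCost_sub_le_energy {p ε α β : ℝ} (hp : 1 < p) (hε : 0 < ε)
    (hαβ : α ≤ β) {U : ℝ → ℝ} (hU : AbsolutelyContinuousOnInterval U α β) :
    ENNReal.ofReal |transitionCost p (U β) - transitionCost p (U α)|
      ≤ energy p ε α β U (deriv U) := by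
  have := ofReal_abs_sub_le_energy (c := 0) hp hε hαβ hU (k := fun _ => 1) contDiff_const
    (fun _ _ => zero_le_one) (by simp)
  simpa using this

theorem energy_mono {p ε a b α β : ℝ} (hα : a ≤ α) (hβ : β ≤ b) (u g : ℝ → ℝ) :
    energy p ε α β u g ≤ energy p ε a b u g :=
  lintegral_mono_set (Ioo_subset_Ioo hα hβ)

theorem energy_add_le {p ε α β γ : ℝ} (h1 : α ≤ β) (h2 : β ≤ γ) (u g : ℝ → ℝ) :
    energy p ε α β u g + energy p ε β γ u g ≤ energy p ε α γ u g := by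
  unfold energy
  rw [← lintegral_union measurableSet_Ioo]
  · exact lintegral_mono_set (union_subset (Ioo_subset_Ioo_right h2) (Ioo_subset_Ioo_left h1))
  · exact disjoint_left.2 fun x hx hx' => lt_asymm hx.2 hx'.1

/-! ### Comparison of the potential with the transition cost near the wells -/

theorem transitionDensity_eq {p : ℝ} (hp : 1 < p) (s : ℝ) :
    transitionDensity p s = (2 * (p - 1)) ^ (-((p - 1) / p)) * |s ^ 2 - 1| ^ (p - 1) := by
  have hp0 : 0 < p := by linarith
  have hp1 : 0 < p - 1 := by linarith
  unfold transitionDensity potential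
  rw [Real.mul_rpow (by positivity) (by positivity), ← mul_assoc,
    ← Real.mul_rpow (by positivity) (by positivity), ← Real.rpow_mul (abs_nonneg _)]
  congr 1
  · rw [Real.rpow_neg (by positivity), ← Real.inv_rpow (by positivity)]
    congr 1
    field_simp
  · congr 1
    field_simp

/-- The constant in `transitionDensity_eq` is the inverse of `λ_p (p - 1)`. -/
theorem decayRate_mul_eq_inv {p : ℝ} (hp : 1 < p) :
    decayRate p * (p - 1) = ((2 * (p - 1)) ^ (-((p - 1) / p)))⁻¹ := by
  have hp1 : 0 < p - 1 := by linarith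
  have hp0 : 0 < p := by linarith
  unfold decayRate
  rw [← Real.rpow_neg (by positivity), neg_neg, Real.mul_rpow (by norm_num) hp1.le, mul_assoc]
  congr 1
  · congr 1
    field_simp
  · nth_rewrite 2 [← Real.rpow_one (p - 1)]
    rw [← Real.rpow_add hp1]
    congr 1
    field_simp
    ring

theorem decayRate_pos {p : ℝ} (hp : 1 < p) : 0 < decayRate p := by
  have hp1 : 0 < p - 1 := by linarith
  unfold decayRate
  positivity

theorem transitionDensity_neg (p s : ℝ) : transitionDensity p (-s) = transitionDensity p s := by
  simp [transitionDensity, potential]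

theorem transitionCost_neg (p s : ℝ) : transitionCost p (-s) = -transitionCost p s := by
  unfold transitionCost
  have := intervalIntegral.integral_comp_neg (a := 0) (b := s) (transitionDensity p)
  simp only [transitionDensity_neg, neg_zero] at this
  rw [intervalIntegral.integral_symm, this]

theorem monotone_transitionCost {p : ℝ} (hp : 1 < p) : Monotone (transitionCost p) := by
  refine monotone_of_deriv_nonneg (fun s => (hasDerivAt_transitionCost hp s).differentiableAt) ?_
  intro s
  rw [(hasDerivAt_transitionCost hp s).deriv]
  exact transitionDensity_nonneg hp s

theorem transitionCost_lt_of_mem_Ioo {p θ : ℝ} (hp : 1 < p) (h0 : 0 < θ) (h1 : θ < 1) :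
    transitionCost p θ < transitionCost p 1 := by
  rw [← sub_pos, transitionCost_sub hp]
  refine intervalIntegral.intervalIntegral_pos_of_pos_on
    ((continuous_transitionDensity hp).intervalIntegrable _ _) ?_ h1
  intro x hx
  have hx0 : 0 < |x ^ 2 - 1| := abs_pos.2 (by nlinarith [hx.1, hx.2])
  have hp1 : 0 < p - 1 := by linarith
  rw [transitionDensity_eq hp]
  positivity

theorem hasDerivAt_potential {p : ℝ} (hp : 1 < p) (s : ℝ) :
    HasDerivAt (potential p) (s * (|s ^ 2 - 1| ^ (p - 2) * (s ^ 2 - 1))) s := by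
  have h1 : HasDerivAt (fun s : ℝ => s ^ 2 - 1) (2 * s) s := by
    simpa using (hasDerivAt_pow 2 s).sub_const 1
  have h2 := ((hasDerivAt_abs_rpow (s ^ 2 - 1) hp).comp s h1).const_mul (1 / (2 * p))
  have hp0 : p ≠ 0 := by linarith
  refine h2.congr_deriv ?_
  field_simp

theorem abs_rpow_sub_two_mul_abs {p y : ℝ} (hy : y ≠ 0) : |y| ^ (p - 2) * |y| = |y| ^ (p - 1) := by
  nth_rewrite 2 [← Real.rpow_one |y|]
  rw [← Real.rpow_add (abs_pos.2 hy)]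
  congr 1
  ring

/-- Since `|F'(s)| = |s| |s² - 1|^(p-1)`, the potential dominates a multiple of the transition cost
to the well as long as `s` stays away from `0`. -/
theorem mul_abs_transitionCost_sub_one_le {p θ s : ℝ} (hp : 1 < p) (h0 : 0 < θ) (h1 : θ < 1)
    (hs : θ ≤ s) :
    θ * |transitionCost p s - transitionCost p 1|
      ≤ (2 * (p - 1)) ^ (-((p - 1) / p)) * potential p s := by
  have hp1 : 0 < p - 1 := by linarith
  set D : ℝ := (2 * (p - 1)) ^ (-((p - 1) / p)) with hD
  have hD0 : 0 ≤ D := by positivity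
  have hpot1 : potential p 1 = 0 := by
    simp [potential, Real.zero_rpow (by linarith : p ≠ 0)]
  have hpc := continuous_potential hp
  have hΦc := (contDiff_transitionCost hp).continuous
  rcases le_total s 1 with hs1 | hs1
  · have hanti : AntitoneOn (fun t => D * potential p t + θ * transitionCost p t) (Icc θ 1) := by
      refine antitoneOn_of_hasDerivWithinAt_nonpos (convex_Icc _ _) (by fun_prop)
        (fun t _ => (((hasDerivAt_potential hp t).const_mul D).add
          ((hasDerivAt_transitionCost hp t).const_mul θ)).hasDerivWithinAt) ?_
      intro t ht
      rw [interior_Icc] at ht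
      have hy : t ^ 2 - 1 < 0 := by nlinarith [ht.1, ht.2]
      have hab := abs_rpow_sub_two_mul_abs (p := p) hy.ne
      have hpos : 0 ≤ |t ^ 2 - 1| ^ (p - 1) := by positivity
      have hsgn : |t ^ 2 - 1| ^ (p - 2) * (t ^ 2 - 1) = -|t ^ 2 - 1| ^ (p - 1) := by
        rw [← hab, abs_of_neg hy]; ring
      rw [transitionDensity_eq hp, hsgn, ← hD]
      have := mul_nonneg (mul_nonneg hD0 hpos) (sub_nonneg.2 ht.1.le)
      linarith
    have := hanti ⟨hs, hs1⟩ ⟨h1.le, le_rfl⟩ hs1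
    simp only [hpot1] at this
    rw [abs_of_nonpos (sub_nonpos.2 (monotone_transitionCost hp hs1))]
    linarith
  · have hmono : MonotoneOn (fun t => D * potential p t - θ * transitionCost p t) (Ici 1) := by
      refine monotoneOn_of_hasDerivWithinAt_nonneg (convex_Ici _) (by fun_prop)
        (fun t _ => (((hasDerivAt_potential hp t).const_mul D).sub
          ((hasDerivAt_transitionCost hp t).const_mul θ)).hasDerivWithinAt) ?_
      intro t ht
      rw [interior_Ici] at ht
      have ht : 1 < t := ht
      have hy : 0 < t ^ 2 - 1 := by nlinarith
      have hab := abs_rpow_sub_two_mul_abs (p := p) hy.ne'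
      have hpos : 0 ≤ |t ^ 2 - 1| ^ (p - 1) := by positivity
      have hsgn : |t ^ 2 - 1| ^ (p - 2) * (t ^ 2 - 1) = |t ^ 2 - 1| ^ (p - 1) := by
        rw [← hab, abs_of_pos hy]
      rw [transitionDensity_eq hp, hsgn, ← hD]
      have := mul_nonneg (mul_nonneg hD0 hpos) (sub_nonneg.2 (h1.trans ht).le)
      linarith
    have := hmono (mem_Ici.2 le_rfl) hs1 hs1
    simp only [hpot1] at this
    rw [abs_of_nonneg (sub_nonneg.2 (monotone_transitionCost hp hs1))]
    linarith

/-- Near the wells `±1` the potential dominates the transition cost to the well, with any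
constant below `λ_p (p - 1)`. -/
theorem exists_mul_abs_transitionCost_sub_le_potential {p θ : ℝ} (hp : 1 < p) (h0 : 0 < θ)
    (h1 : θ < 1) :
    ∃ m > 0, ∀ τ : ℝ, (τ = -1 ∨ τ = 1) → ∀ s, |transitionCost p s - transitionCost p τ| ≤ 2 * m →
      θ * (decayRate p * (p - 1)) * |transitionCost p s - transitionCost p τ|
        ≤ potential p s := by
  have hp1 : 0 < p - 1 := by linarith
  have hlt := transitionCost_lt_of_mem_Ioo hp h0 h1
  set m := (transitionCost p 1 - transitionCost p θ) / 4 with hm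
  have hm0 : 0 < m := by linarith
  have hD0 : 0 < (2 * (p - 1)) ^ (-((p - 1) / p)) := by positivity
  have pos : ∀ s, |transitionCost p s - transitionCost p 1| ≤ 2 * m →
      θ * (decayRate p * (p - 1)) * |transitionCost p s - transitionCost p 1|
        ≤ potential p s := by
    intro s hs
    have hθs : θ ≤ s := by
      by_contra hcon
      have := monotone_transitionCost hp (not_le.1 hcon).le
      have := neg_le_of_abs_le hs
      linarith
    have := mul_abs_transitionCost_sub_one_le hp h0 h1 hθs
    rw [decayRate_mul_eq_inv hp, mul_right_comm, ← div_eq_mul_inv, div_le_iff₀ hD0]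
    linarith
  refine ⟨m, hm0, ?_⟩
  rintro τ (rfl | rfl) s hs
  · have e : |transitionCost p s - transitionCost p (-1)|
        = |transitionCost p (-s) - transitionCost p 1| := by
      rw [transitionCost_neg, transitionCost_neg, ← abs_neg]; congr 1; ring
    have e2 : potential p s = potential p (-s) := by simp [potential]
    rw [e] at hs ⊢
    rw [e2]
    exact pos (-s) hs
  · exact pos s hs

/-! ### Exponentially small loss at the ends of a transition layer -/

/-- For an exponent `q > 1` the share `1 - (1-e)^q` of the potential energy is at least
`q e / (1 + (q-1) e)`; this has the exact slope `q` at `e = 0` and equality at `e = 1`. -/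
theorem mul_le_one_sub_rpow_mul {q e : ℝ} (hq : 1 < q) (h0 : 0 ≤ e) (h1 : e ≤ 1) :
    q * e ≤ (1 - (1 - e) ^ q) * (1 + (q - 1) * e) := by
  have hm : 0 < q - 1 := by linarith
  have ha : (1 - e) ^ (q - 1) ≤ Real.exp (-((q - 1) * e)) := by
    have h2 : 1 - e ≤ Real.exp (-e) := Real.one_sub_le_exp_neg e
    calc (1 - e) ^ (q - 1) ≤ Real.exp (-e) ^ (q - 1) :=
          Real.rpow_le_rpow (by linarith) h2 hm.le
      _ = Real.exp (-((q - 1) * e)) := by rw [← Real.exp_mul]; congr 1; ring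
  have hb : 1 + (q - 1) * e ≤ Real.exp ((q - 1) * e) := by
    linarith [Real.add_one_le_exp ((q - 1) * e)]
  have hc : (1 - e) ^ (q - 1) * (1 + (q - 1) * e) ≤ 1 := by
    calc _ ≤ Real.exp (-((q - 1) * e)) * Real.exp ((q - 1) * e) :=
          mul_le_mul ha hb (by positivity) (Real.exp_pos _).le
      _ = 1 := by rw [← Real.exp_add]; simp
  have hd : (1 - e) ^ q = (1 - e) ^ (q - 1) * (1 - e) := by
    rcases h1.lt_or_eq with h1 | rfl
    · nth_rewrite 3 [← Real.rpow_one (1 - e)]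
      rw [← Real.rpow_add (by linarith)]
      congr 1; ring
    · simp [Real.zero_rpow (by linarith : q ≠ 0)]
  have he := mul_le_mul_of_nonneg_right hc (sub_nonneg.2 h1)
  rw [hd]
  linarith

/-- The calibration inequality for the weights `k = 1 - e`, where `e` decays exponentially away
from the endpoint `y`. The endpoints `x` and `y` may come in either order. -/
theorem ofReal_abs_sub_le_energy_of_exp {p ε κ ν e₁ c x y : ℝ} (hp : 1 < p) (hε : 0 < ε)
    (hκ : 0 < κ) (hν : 0 < ν) (he0 : 0 ≤ e₁) (he1 : e₁ ≤ 1)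
    (hνκ : ν * (1 + (p / (p - 1) - 1) * e₁) ≤ p / (p - 1) * κ)
    {U : ℝ → ℝ} (hU : AbsolutelyContinuousOnInterval U x y)
    (hwell : ∀ z ∈ uIcc x y, κ * |transitionCost p (U z) - c| ≤ potential p (U z)) :
    ENNReal.ofReal |(1 - e₁) * (transitionCost p (U y) - c)
        - (1 - e₁ * Real.exp (-(ν * |x - y| / ε))) * (transitionCost p (U x) - c)|
      ≤ energy p ε (min x y) (max x y) U (deriv U) := by
  have hq : 1 < p / (p - 1) := by rw [lt_div_iff₀] <;> linarith
  set q := p / (p - 1) with hqdef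
  -- `σ` is the direction in which `e` increases
  have main : ∀ σ α β : ℝ, |σ| = 1 → α ≤ β → AbsolutelyContinuousOnInterval U α β →
      (∀ z ∈ Icc α β, κ * |transitionCost p (U z) - c| ≤ potential p (U z)) →
      (∀ z ∈ Icc α β, σ * (z - y) ≤ 0) →
      ENNReal.ofReal |(1 - e₁ * Real.exp (σ * ν / ε * (β - y))) * (transitionCost p (U β) - c)
        - (1 - e₁ * Real.exp (σ * ν / ε * (α - y))) * (transitionCost p (U α) - c)|
      ≤ energy p ε α β U (deriv U) := by
    intro σ α β hσ hαβ hUac hw hneg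
    have hder : ∀ z, HasDerivAt (fun z => 1 - e₁ * Real.exp (σ * ν / ε * (z - y)))
        (-(e₁ * (Real.exp (σ * ν / ε * (z - y)) * (σ * ν / ε)))) z := by
      intro z
      have h1 : HasDerivAt (fun z => σ * ν / ε * (z - y)) (σ * ν / ε) z := by
        simpa using ((hasDerivAt_id z).sub_const y).const_mul (σ * ν / ε)
      exact (h1.exp.const_mul e₁).const_sub 1
    have hexp : ∀ z ∈ Icc α β, Real.exp (σ * ν / ε * (z - y)) ≤ 1 := by
      intro z hz
      rw [Real.exp_le_one_iff]
      have : σ * ν / ε * (z - y) = ν / ε * (σ * (z - y)) := by ring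
      rw [this]
      exact mul_nonpos_of_nonneg_of_nonpos (by positivity) (hneg z hz)
    refine ofReal_abs_sub_le_energy hp hε hαβ hUac
      (k := fun z => 1 - e₁ * Real.exp (σ * ν / ε * (z - y))) (by fun_prop) ?_ ?_
    · intro z hz
      have := mul_le_one₀ he1 (Real.exp_pos (σ * ν / ε * (z - y))).le (hexp z hz)
      linarith
    · intro z hz
      rw [(hder z).deriv, ← hqdef]
      have hee : e₁ * Real.exp (σ * ν / ε * (z - y)) ≤ e₁ :=
        mul_le_of_le_one_right he0 (hexp z hz)
      have he_nonneg : 0 ≤ e₁ * Real.exp (σ * ν / ε * (z - y)) := by positivity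
      have hd : |-(e₁ * (Real.exp (σ * ν / ε * (z - y)) * (σ * ν / ε)))|
          = e₁ * Real.exp (σ * ν / ε * (z - y)) * (ν / ε) := by
        rw [abs_neg, ← mul_assoc, abs_mul, abs_of_nonneg he_nonneg, abs_div, abs_mul, hσ,
          abs_of_pos hν, abs_of_pos hε, one_mul]
      rw [hd]
      set e := e₁ * Real.exp (σ * ν / ε * (z - y)) with he
      have hkey := mul_le_one_sub_rpow_mul hq he_nonneg (hee.trans he1)
      have hden : 0 < 1 + (q - 1) * e := by
        have := mul_nonneg (sub_nonneg.2 hq.le) he_nonneg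
        linarith
      have hshare : ν * e ≤ (1 - (1 - e) ^ q) * κ := by
        have h3 : ν * (1 + (q - 1) * e) ≤ q * κ := by
          refine le_trans ?_ hνκ
          have := mul_le_mul_of_nonneg_left hee (sub_nonneg.2 hq.le)
          gcongr
        refine le_of_mul_le_mul_right ?_ hden
        calc ν * e * (1 + (q - 1) * e) = e * (ν * (1 + (q - 1) * e)) := by ring
          _ ≤ e * (q * κ) := by gcongr
          _ = κ * (q * e) := by ring
          _ ≤ κ * ((1 - (1 - e) ^ q) * (1 + (q - 1) * e)) := by gcongr
          _ = _ := by ring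
      have hnn : 0 ≤ 1 - (1 - e) ^ q := by
        have : (1 - e) ^ q ≤ 1 := Real.rpow_le_one (by linarith) (by linarith) (by linarith)
        linarith
      calc ε * (e * (ν / ε) * |transitionCost p (U z) - c|)
          = ν * e * |transitionCost p (U z) - c| := by field_simp
        _ ≤ (1 - (1 - e) ^ q) * κ * |transitionCost p (U z) - c| := by gcongr
        _ = (1 - (1 - e) ^ q) * (κ * |transitionCost p (U z) - c|) := by ring
        _ ≤ _ := mul_le_mul_of_nonneg_left (hw z hz) hnn
  rcases le_total x y with hxy | hxy
  · rw [min_eq_left hxy, max_eq_right hxy]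
    have := main 1 x y (by norm_num) hxy hU (by rwa [uIcc_of_le hxy] at hwell)
      (fun z hz => by linarith [hz.2])
    rw [abs_of_nonpos (sub_nonpos.2 hxy)]
    convert this using 6
    · simp
    · congr 2; ring
  · rw [min_eq_right hxy, max_eq_left hxy]
    have := main (-1) y x (by norm_num) hxy hU.symm (by rwa [uIcc_of_ge hxy] at hwell)
      (fun z hz => by linarith [hz.1])
    rw [abs_of_nonneg (sub_nonneg.2 hxy), abs_sub_comm]
    convert this using 6
    · congr 2; ring
    · simp

/-- Suppose the potential dominates `κ |Φ - c|` where `|Φ - c| ≤ 2m`, and `|Φ(U x) - c| ≤ m`. Then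
the energy between `x` and `y` is at least `|Φ(U x) - c|`, up to a relative error that is
exponentially small in the distance of `x` and `y`, at any rate `ν` below `κ p / (p - 1)`. No
condition is imposed on `U` at `y`. -/
theorem exists_ofReal_mul_abs_le_energy {p κ ν : ℝ} (hp : 1 < p) (hκ : 0 < κ) (hν : 0 < ν)
    (hνκ : ν < p / (p - 1) * κ) :
    ∃ K T : ℝ, 0 < K ∧ 0 ≤ T ∧ ∀ (ε m c x y : ℝ) (U : ℝ → ℝ), 0 < ε →
      AbsolutelyContinuousOnInterval U x y →
      (∀ s, |transitionCost p s - c| ≤ 2 * m → κ * |transitionCost p s - c| ≤ potential p s) →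
      |transitionCost p (U x) - c| ≤ m → T * ε ≤ |x - y| →
      ENNReal.ofReal ((1 - K * Real.exp (-(ν * |x - y| / ε))) * |transitionCost p (U x) - c|)
        ≤ energy p ε (min x y) (max x y) U (deriv U) := by
  have hq : 1 < p / (p - 1) := by rw [lt_div_iff₀] <;> linarith
  set q := p / (p - 1) with hqdef
  have hq1 : 0 < q - 1 := by linarith
  set e₁ : ℝ := min 1 ((q * κ - ν) / (ν * (q - 1))) with he₁
  have he0 : 0 < e₁ := lt_min one_pos (div_pos (by linarith) (by positivity))
  have he1 : e₁ ≤ 1 := min_le_left _ _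
  have hνe : ν * (1 + (q - 1) * e₁) ≤ q * κ := by
    have h1 : e₁ ≤ (q * κ - ν) / (ν * (q - 1)) := min_le_right _ _
    rw [le_div_iff₀ (by positivity)] at h1
    linarith
  -- `T ε` is the length on which `e` grows from `e₁` to `1` at the slow rate `κ / ε`
  set T : ℝ := -Real.log e₁ / κ with hT
  have hT0 : 0 ≤ T := div_nonneg (neg_nonneg.2 (Real.log_nonpos he0.le he1)) hκ.le
  refine ⟨e₁ * Real.exp (ν * T), T, by positivity, hT0, ?_⟩
  intro ε m c x y U hε hU hwell hx hTε
  by_cases hesc : ∃ z ∈ uIcc x y, 2 * m < |transitionCost p (U z) - c|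
  · -- leaving the neighbourhood of the well costs at least `m`
    obtain ⟨z, hz, hzm⟩ := hesc
    have hsub : uIcc x z ⊆ uIcc x y := uIcc_subset_uIcc left_mem_uIcc hz
    have h1 : ENNReal.ofReal |transitionCost p (U z) - transitionCost p (U x)|
        ≤ energy p ε (min x z) (max x z) U (deriv U) := by
      rcases le_total x z with h | h
      · rw [min_eq_left h, max_eq_right h]
        exact ofReal_abs_transitionCost_sub_le_energy hp hε h (hU.mono hsub)
      · rw [min_eq_right h, max_eq_left h, abs_sub_comm]
        exact ofReal_abs_transitionCost_sub_le_energy hp hε h (hU.mono hsub).symm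
    have h2 : energy p ε (min x z) (max x z) U (deriv U)
        ≤ energy p ε (min x y) (max x y) U (deriv U) :=
      energy_mono (le_min (min_le_left _ _) hz.1) (max_le (le_max_left _ _) hz.2) _ _
    refine le_trans (ENNReal.ofReal_le_ofReal ?_) (h1.trans h2)
    have h3 := abs_sub_abs_le_abs_sub (transitionCost p (U z) - c) (transitionCost p (U x) - c)
    rw [sub_sub_sub_cancel_right] at h3
    have h4 : (1 - e₁ * Real.exp (ν * T) * Real.exp (-(ν * |x - y| / ε)))
        * |transitionCost p (U x) - c| ≤ |transitionCost p (U x) - c| := by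
      refine mul_le_of_le_one_left (abs_nonneg _) ?_
      have : 0 ≤ e₁ * Real.exp (ν * T) * Real.exp (-(ν * |x - y| / ε)) := by positivity
      linarith
    linarith
  · push Not at hesc
    obtain ⟨w, hwI, hwy, hxw⟩ :
        ∃ w ∈ uIcc x y, |w - y| = T * ε ∧ |x - w| = |x - y| - T * ε := by
      have hTε0 : 0 ≤ T * ε := by positivity
      rcases le_total x y with h | h
      · rw [abs_of_nonpos (sub_nonpos.2 h)] at hTε ⊢
        refine ⟨y - T * ε, by rw [uIcc_of_le h]; constructor <;> linarith, ?_, ?_⟩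
        · rw [abs_of_nonpos (by linarith)]; ring
        · rw [abs_of_nonpos (by linarith)]; ring
      · rw [abs_of_nonneg (sub_nonneg.2 h)] at hTε ⊢
        refine ⟨y + T * ε, by rw [uIcc_of_ge h]; constructor <;> linarith, ?_, ?_⟩
        · rw [abs_of_nonneg (by linarith)]; ring
        · rw [abs_of_nonneg (by linarith)]; ring
    have hsub1 : uIcc x w ⊆ uIcc x y := uIcc_subset_uIcc left_mem_uIcc hwI
    have hsub2 : uIcc w y ⊆ uIcc x y := uIcc_subset_uIcc hwI right_mem_uIcc
    have h1 := ofReal_abs_sub_le_energy_of_exp hp hε hκ hν he0.le he1 hνe (hU.mono hsub1)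
      (fun z hz => hwell _ (hesc z (hsub1 hz)))
    have h2 := ofReal_abs_sub_le_energy_of_exp (ν := κ) (e₁ := 1) hp hε hκ hκ zero_le_one le_rfl
      (by rw [← hqdef]; linarith) (hU.mono hsub2)
      (fun z hz => hwell _ (hesc z (hsub2 hz)))
    have h3 : energy p ε (min x w) (max x w) U (deriv U)
        + energy p ε (min w y) (max w y) U (deriv U)
        ≤ energy p ε (min x y) (max x y) U (deriv U) := by
      rcases le_total x y with h | h
      · rw [uIcc_of_le h] at hwI
        rw [min_eq_left h, max_eq_right h, min_eq_left hwI.1, max_eq_right hwI.1,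
          min_eq_left hwI.2, max_eq_right hwI.2]
        exact energy_add_le hwI.1 hwI.2 _ _
      · rw [uIcc_of_ge h] at hwI
        rw [min_eq_right h, max_eq_left h, min_eq_right hwI.1, max_eq_left hwI.1,
          min_eq_right hwI.2, max_eq_left hwI.2, add_comm]
        exact energy_add_le hwI.1 hwI.2 _ _
    refine le_trans ?_ ((add_le_add h1 h2).trans h3)
    rw [← ENNReal.ofReal_add (abs_nonneg _) (abs_nonneg _)]
    refine ENNReal.ofReal_le_ofReal ?_
    have e2 : Real.exp (-(κ * |w - y| / ε)) = e₁ := by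
      rw [hwy, hT]
      have : -(κ * (-Real.log e₁ / κ * ε) / ε) = Real.log e₁ := by field_simp
      rw [this, Real.exp_log he0]
    have e3 : e₁ * Real.exp (-(ν * |x - w| / ε))
        = e₁ * Real.exp (ν * T) * Real.exp (-(ν * |x - y| / ε)) := by
      rw [hxw, mul_assoc, ← Real.exp_add]
      congr 2; field_simp; ring
    rw [e2, e3, sub_self, zero_mul, one_mul, zero_sub, abs_neg]
    have h4 := le_abs_self (1 - e₁ * Real.exp (ν * T) * Real.exp (-(ν * |x - y| / ε)))
    have h5 := abs_sub_abs_le_abs_sub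
      ((1 - e₁ * Real.exp (ν * T) * Real.exp (-(ν * |x - y| / ε))) * (transitionCost p (U x) - c))
      ((1 - e₁) * (transitionCost p (U w) - c))
    rw [abs_mul, abs_sub_comm _ ((1 - e₁) * (transitionCost p (U w) - c))] at h5
    have h6 := mul_le_mul_of_nonneg_right h4 (abs_nonneg (transitionCost p (U x) - c))
    linarith

/-! ### Energy of a single transition layer -/

/-- The energy of a function on `(h - r, h + r)` that is close to opposite wells at points
`x₁ ≤ x₂` within `ρ` of `h` is at least the transition energy, up to an exponentially small
relative error. -/
theorem exists_ofReal_mul_transitionEnergy_le_energy {p κ ν m : ℝ} (hp : 1 < p) (hκ : 0 < κ)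
    (hν : 0 < ν) (hνκ : ν < p / (p - 1) * κ)
    (hwell : ∀ τ : ℝ, (τ = -1 ∨ τ = 1) → ∀ s, |transitionCost p s - transitionCost p τ| ≤ 2 * m →
      κ * |transitionCost p s - transitionCost p τ| ≤ potential p s) :
    ∃ K T : ℝ, 0 < K ∧ 0 ≤ T ∧ ∀ (ε h r ρ x₁ x₂ τ : ℝ) (U : ℝ → ℝ), 0 < ε → ρ ≤ r →
      AbsolutelyContinuousOnInterval U (h - r) (h + r) → (τ = -1 ∨ τ = 1) →
      x₁ ∈ Icc (h - ρ) h → x₂ ∈ Icc h (h + ρ) →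
      |transitionCost p (U x₁) - transitionCost p (-τ)| ≤ m →
      |transitionCost p (U x₂) - transitionCost p τ| ≤ m → T * ε ≤ r - ρ →
      ENNReal.ofReal ((1 - K * Real.exp (-(ν * (r - ρ) / ε))) * transitionEnergy p)
        ≤ energy p ε (h - r) (h + r) U (deriv U) := by
  obtain ⟨K, T, hK, hT, hend⟩ := exists_ofReal_mul_abs_le_energy hp hκ hν hνκ
  refine ⟨K, T, hK, hT, ?_⟩
  intro ε h r ρ x₁ x₂ τ U hε hρr hU hτ hx₁ hx₂ hm₁ hm₂ hTε
  set E := K * Real.exp (-(ν * (r - ρ) / ε)) with hE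
  have hE0 : 0 ≤ E := by positivity
  have hc := transitionEnergy_nonneg hp
  rcases lt_or_ge 1 E with hE1 | hE1
  · rw [ENNReal.ofReal_of_nonpos (mul_nonpos_of_nonpos_of_nonneg (by linarith) hc)]
    exact zero_le
  have hτ' : -τ = -1 ∨ -τ = 1 := by rcases hτ with rfl | rfl <;> norm_num
  have hexp : ∀ {d a : ℝ}, r - ρ ≤ d → 0 ≤ a →
      (1 - E) * a ≤ (1 - K * Real.exp (-(ν * d / ε))) * a := by
    intro d a hd ha
    have : Real.exp (-(ν * d / ε)) ≤ Real.exp (-(ν * (r - ρ) / ε)) := by gcongr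
    have := mul_le_mul_of_nonneg_left this hK.le
    exact mul_le_mul_of_nonneg_right (by linarith) ha
  have hsub : ∀ {x y : ℝ}, x ∈ Icc (h - r) (h + r) → y ∈ Icc (h - r) (h + r) →
      AbsolutelyContinuousOnInterval U x y := fun {x y} hx hy => hU.mono (uIcc_subset_uIcc
    (by rwa [uIcc_of_le (hx.1.trans hx.2)]) (by rwa [uIcc_of_le (hx.1.trans hx.2)]))
  have I₁ : x₁ ∈ Icc (h - r) (h + r) := ⟨by linarith [hx₁.1], by linarith [hx₁.1, hx₁.2]⟩
  have I₂ : x₂ ∈ Icc (h - r) (h + r) := ⟨by linarith [hx₂.1, hx₂.2], by linarith [hx₂.2]⟩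
  have Il : h - r ∈ Icc (h - r) (h + r) := ⟨le_rfl, I₁.1.trans I₁.2⟩
  have Ir : h + r ∈ Icc (h - r) (h + r) := ⟨I₁.1.trans I₁.2, le_rfl⟩
  have hd₁ : r - ρ ≤ |x₁ - (h - r)| := by
    rw [abs_of_nonneg (by linarith [I₁.1])]; linarith [hx₁.1]
  have hd₂ : r - ρ ≤ |x₂ - (h + r)| := by
    rw [abs_of_nonpos (by linarith [I₂.2])]; linarith [hx₂.2]
  have b₁ := hend ε m (transitionCost p (-τ)) x₁ (h - r) U hε (hsub I₁ Il) (hwell _ hτ') hm₁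
    (hTε.trans hd₁)
  have b₂ := hend ε m (transitionCost p τ) x₂ (h + r) U hε (hsub I₂ Ir) (hwell _ hτ) hm₂
    (hTε.trans hd₂)
  have b₀ := ofReal_abs_transitionCost_sub_le_energy hp hε (hx₁.2.trans hx₂.1) (hsub I₁ I₂)
  rw [min_eq_right I₁.1, max_eq_left I₁.1] at b₁
  rw [min_eq_left I₂.2, max_eq_right I₂.2] at b₂
  have c₁ := (ENNReal.ofReal_le_ofReal (hexp hd₁ (abs_nonneg _))).trans b₁
  have c₂ := (ENNReal.ofReal_le_ofReal (hexp hd₂ (abs_nonneg _))).trans b₂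
  have hadd : energy p ε (h - r) x₁ U (deriv U) + energy p ε x₁ x₂ U (deriv U)
      + energy p ε x₂ (h + r) U (deriv U) ≤ energy p ε (h - r) (h + r) U (deriv U) :=
    (add_le_add (energy_add_le I₁.1 (hx₁.2.trans hx₂.1) _ _) le_rfl).trans
      (energy_add_le I₂.1 I₂.2 _ _)
  refine le_trans ?_ ((add_le_add (add_le_add c₁ b₀) c₂).trans hadd)
  have h1E : 0 ≤ 1 - E := by linarith
  rw [← ENNReal.ofReal_add (mul_nonneg h1E (abs_nonneg _)) (abs_nonneg _),
    ← ENNReal.ofReal_add (add_nonneg (mul_nonneg h1E (abs_nonneg _)) (abs_nonneg _))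
      (mul_nonneg h1E (abs_nonneg _))]
  refine ENNReal.ofReal_le_ofReal ?_
  have htri : transitionEnergy p ≤ |transitionCost p (U x₁) - transitionCost p (-τ)|
      + |transitionCost p (U x₂) - transitionCost p (U x₁)|
      + |transitionCost p (U x₂) - transitionCost p τ| := by
    have e : transitionEnergy p = |transitionCost p τ - transitionCost p (-τ)| := by
      rcases hτ with rfl | rfl
      · rw [neg_neg, abs_sub_comm, ← transitionEnergy_eq hp, abs_of_nonneg hc]
      · rw [← transitionEnergy_eq hp, abs_of_nonneg hc]
    rw [e, abs_sub_comm (transitionCost p (U x₂)) (transitionCost p τ)]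
    have h1 := abs_sub_le (transitionCost p τ) (transitionCost p (U x₂)) (transitionCost p (-τ))
    have h2 := abs_sub_le (transitionCost p (U x₂)) (transitionCost p (U x₁))
      (transitionCost p (-τ))
    linarith
  have h3 := mul_le_mul_of_nonneg_left htri h1E
  have h4 : (1 - E) * |transitionCost p (U x₂) - transitionCost p (U x₁)|
      ≤ |transitionCost p (U x₂) - transitionCost p (U x₁)| :=
    mul_le_of_le_one_left (abs_nonneg _) (by linarith)
  linarith

/-! ### Jump functions and `L¹` closeness -/

/-- On either side of a jump point `v` is constant, with opposite values `-τ` and `τ`. -/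
theorem IsJumpFunction.exists_sign {a b r : ℝ} {N : ℕ} {h : Fin N → ℝ} {v : ℝ → ℝ}
    (hv : IsJumpFunction a b h v) (hr : 0 < r) (hsep : ∀ i j, i < j → h i + r < h j - r)
    (hleft : ∀ i, a ≤ h i - r) (hright : ∀ i, h i + r ≤ b) (i : Fin N) :
    ∃ τ : ℝ, (τ = -1 ∨ τ = 1) ∧ (∀ x ∈ Ioo (h i - r) (h i), v x = -τ) ∧
      ∀ x ∈ Ioo (h i) (h i + r), v x = τ := by
  have hother : ∀ j, j ≠ i → h j ∉ Ioo (h i - r) (h i + r) := by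
    intro j hj hI
    rcases lt_or_gt_of_ne hj with hji | hji
    · linarith [hsep j i hji, hI.1]
    · linarith [hsep i j hji, hI.2]
  have hconst : ∀ x y, x ∈ Ioo (h i - r) (h i + r) → y ∈ Ioo (h i - r) (h i + r) → x ≤ y →
      h i ∉ Icc x y → v x = v y := by
    intro x y hx hy hxy hi
    refine hv.const x ⟨by linarith [hleft i, hx.1], by linarith [hright i, hx.2]⟩
      y ⟨by linarith [hleft i, hy.1], by linarith [hright i, hy.2]⟩ hxy fun j hj => ?_
    rcases eq_or_ne j i with rfl | hji
    · exact hi hj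
    · exact hother j hji ⟨hx.1.trans_le hj.1, hj.2.trans_lt hy.2⟩
  obtain ⟨s, hsl, hsr⟩ := hv.jump i
  obtain ⟨y, hy, hyI⟩ := (hsl.and (Ioo_mem_nhdsLT (show h i - r < h i by linarith))).exists
  obtain ⟨z, hz, hzI⟩ := (hsr.and (Ioo_mem_nhdsGT (show h i < h i + r by linarith))).exists
  refine ⟨s, ?_, fun x hx => ?_, fun x hx => ?_⟩
  · rw [← hz]
    exact hv.values z ⟨by linarith [hleft i, hzI.1], by linarith [hright i, hzI.2]⟩
  · have hx' : x ∈ Ioo (h i - r) (h i + r) := ⟨hx.1, by linarith [hx.2]⟩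
    have hy' : y ∈ Ioo (h i - r) (h i + r) := ⟨hyI.1, by linarith [hyI.2]⟩
    rw [← hy]
    rcases le_total x y with hxy | hxy
    · exact hconst x y hx' hy' hxy fun hI => by linarith [hI.2, hyI.2]
    · exact (hconst y x hy' hx' hxy fun hI => by linarith [hI.2, hx.2]).symm
  · have hx' : x ∈ Ioo (h i - r) (h i + r) := ⟨by linarith [hx.1], hx.2⟩
    have hz' : z ∈ Ioo (h i - r) (h i + r) := ⟨by linarith [hzI.1], hzI.2⟩
    rw [← hz]
    rcases le_total x z with hxz | hxz
    · exact hconst x z hx' hz' hxz fun hI => by linarith [hI.1, hx.1]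
    · exact (hconst z x hz' hx' hxz fun hI => by linarith [hI.1, hzI.1]).symm

/-- A representative of a function that is `L¹`-close to `v` is close to the constant value of `v` on
a subinterval at some point of that subinterval. -/
theorem exists_mem_Ioo_abs_sub_lt {a b c d δ η τ : ℝ} {u U v : ℝ → ℝ} (hac : a ≤ c) (hcd : c < d)
    (hdb : d ≤ b) (hη : 0 < η) (hv : ∀ x ∈ Ioo c d, v x = τ)
    (huU : ∀ᵐ x ∂volume.restrict (Ioo a b), u x = U x)
    (hL : eLpNorm (u - v) 1 (volume.restrict (Ioo a b)) ≤ ENNReal.ofReal δ)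
    (hδ : δ < η * (d - c)) : ∃ x ∈ Ioo c d, |U x - τ| < η := by
  by_contra! hcon
  have h1 : ENNReal.ofReal (η * (d - c)) ≤ ENNReal.ofReal δ := by
    calc ENNReal.ofReal (η * (d - c)) = ∫⁻ _ in Ioo c d, ENNReal.ofReal η := by
          rw [setLIntegral_const, Real.volume_Ioo, ENNReal.ofReal_mul hη.le]
      _ ≤ ∫⁻ x in Ioo c d, ‖(U - v) x‖ₑ := by
          refine setLIntegral_mono' measurableSet_Ioo fun x hx => ?_
          rw [← ofReal_norm, Pi.sub_apply, hv x hx, Real.norm_eq_abs]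
          exact ENNReal.ofReal_le_ofReal (hcon x hx)
      _ ≤ ∫⁻ x in Ioo a b, ‖(U - v) x‖ₑ := lintegral_mono_set (Ioo_subset_Ioo hac hdb)
      _ = ∫⁻ x in Ioo a b, ‖(u - v) x‖ₑ := by
          refine lintegral_congr_ae ?_
          filter_upwards [huU] with x hx
          simp only [Pi.sub_apply, hx]
      _ ≤ ENNReal.ofReal δ := by rwa [eLpNorm_one_eq_lintegral_enorm] at hL
  rcases ENNReal.ofReal_le_ofReal_iff'.1 h1 with h2 | h2
  · linarith
  · exact h2.not_gt (mul_pos hη (sub_pos.2 hcd))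

/-! ### The energy of `N` layers -/

theorem sum_energy_le {p ε a b r : ℝ} {N : ℕ} {h : Fin N → ℝ}
    (hsep : ∀ i j, i < j → h i + r < h j - r) (hleft : ∀ i, a ≤ h i - r)
    (hright : ∀ i, h i + r ≤ b) (u g : ℝ → ℝ) :
    ∑ i, energy p ε (h i - r) (h i + r) u g ≤ energy p ε a b u g := by
  unfold energy
  have hdisj : Pairwise (Function.onFun Disjoint fun i => Ioo (h i - r) (h i + r)) := by
    intro i j hij
    refine disjoint_left.2 fun x hx hx' => ?_
    rcases lt_or_gt_of_ne hij with hlt | hlt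
    · linarith [hsep i j hlt, hx.2, hx'.1]
    · linarith [hsep j i hlt, hx'.2, hx.1]
  have := lintegral_iUnion (μ := volume) (fun i => measurableSet_Ioo) hdisj
    (fun x => ENNReal.ofReal (ε ^ (p - 1) * |g x| ^ p / p + potential p (u x) / ε))
  rw [tsum_fintype] at this
  rw [← this]
  exact lintegral_mono_set (iUnion_subset fun i => Ioo_subset_Ioo (hleft i) (hright i))

theorem mainTheorem4 (p : ℝ) (hp : 1 < p) (a b : ℝ) (hab : a < b)
    (N : ℕ) (h : Fin N → ℝ) (v : ℝ → ℝ) (hv : IsJumpFunction a b h v)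
    (r : ℝ) (hr : 0 < r)
    (hsep : ∀ i j, i < j → h i + r < h j - r)
    (hleft : ∀ i, a ≤ h i - r) (hright : ∀ i, h i + r ≤ b)
    (A : ℝ) (hA : 0 < A) (hAr : A < r * √2 * decayRate p) :
    ∃ ε₀ C δ : ℝ, 0 < ε₀ ∧ 0 < C ∧ 0 < δ ∧
      ∀ u u' : ℝ → ℝ, MemH1 a b u u' →
        eLpNorm (u - v) 1 (volume.restrict (Ioo a b)) ≤ ENNReal.ofReal δ →
        ∀ ε : ℝ, 0 < ε → ε < ε₀ →
          ((N * transitionEnergy p - C * Real.exp (-(A * p) / (2 * ε)) : ℝ) : EReal)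
            ≤ (energy p ε a b u u' : EReal) := by
  have hp1 : 0 < p - 1 := by linarith
  have hp0 : 0 < p := by linarith
  have hlam := decayRate_pos hp
  have hcp := transitionEnergy_nonneg hp
  -- Rates 9/10 and 8/10 of the optimal ones suffice: over a length of `9r/10` they give the
  -- exponent `(8/10) (9/10) p λ r`, which exceeds `A p / 2` because `√2 / 2 < 72/100`.
  obtain ⟨m, hm, hwell⟩ := exists_mul_abs_transitionCost_sub_le_potential (θ := 9 / 10) hp
    (by norm_num) (by norm_num)
  obtain ⟨K, T, hK, hT, hlayer⟩ := exists_ofReal_mul_transitionEnergy_le_energy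
    (ν := 8 / 10 * (p * decayRate p)) hp (by positivity) (by positivity)
    (by
      have : p / (p - 1) * (9 / 10 * (decayRate p * (p - 1))) = 9 / 10 * (p * decayRate p) := by
        field_simp
      rw [this]
      have : 0 < p * decayRate p := by positivity
      linarith) hwell
  have hνA : A * p / 2 ≤ 8 / 10 * (p * decayRate p) * (r - r / 10) := by
    have h2 : √2 ≤ 144 / 100 := by
      rw [Real.sqrt_le_left (by norm_num)]; norm_num
    have h3 : r * √2 * decayRate p ≤ r * (144 / 100) * decayRate p := by gcongr
    have h4 : A * p ≤ r * (144 / 100) * decayRate p * p := by gcongr; linarith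
    linarith
  obtain ⟨η, hη, hclose⟩ : ∃ η > 0, ∀ τ : ℝ, (τ = -1 ∨ τ = 1) → ∀ s, |s - τ| < η →
      |transitionCost p s - transitionCost p τ| ≤ m := by
    have hc := (contDiff_transitionCost hp).continuous
    obtain ⟨η₁, h₁, hη₁⟩ := Metric.continuous_iff.1 hc (-1) m hm
    obtain ⟨η₂, h₂, hη₂⟩ := Metric.continuous_iff.1 hc 1 m hm
    refine ⟨min η₁ η₂, lt_min h₁ h₂, ?_⟩
    rintro τ (rfl | rfl) s hs
    · exact (hη₁ s (hs.trans_le (min_le_left _ _))).le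
    · exact (hη₂ s (hs.trans_le (min_le_right _ _))).le
  refine ⟨(r - r / 10) / (T + 1), N * transitionEnergy p * K + 1, η * (r / 10) / 2,
    div_pos (by linarith) (by linarith), by positivity, by positivity, ?_⟩
  intro u g hu hL ε hε hεlt
  have hTε : T * ε ≤ r - r / 10 := by
    rw [lt_div_iff₀ (by linarith)] at hεlt
    linarith
  have hδ : η * (r / 10) / 2 < η * (r / 10) := half_lt_self (by positivity)
  obtain ⟨c, hc⟩ := hu.exists_ae_eq_primitive hab
  have hg := hu.intervalIntegrable_deriv hab
  set U : ℝ → ℝ := fun x => c + ∫ t in a..x, g t with hU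
  have hUac : AbsolutelyContinuousOnInterval U a b := by
    refine AbsolutelyContinuousOnInterval.fun_add ?_
      (hg.absolutelyContinuousOnInterval_intervalIntegral left_mem_uIcc)
    exact contDiff_const.contDiffOn.absolutelyContinuousOnInterval
  have hEeq : energy p ε a b U (deriv U) = energy p ε a b u g := by
    unfold energy
    refine lintegral_congr_ae ?_
    have hd : ∀ᵐ x ∂volume.restrict (Ioo a b), deriv U x = g x := by
      rw [ae_restrict_iff' measurableSet_Ioo]
      filter_upwards [hg.ae_hasDerivAt_integral] with x hx hxI
      exact ((hx (by rw [uIcc_of_le hab.le]; exact Ioo_subset_Icc_self hxI) a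
        left_mem_uIcc).const_add c).deriv
    filter_upwards [hc, hd] with x hx hx'
    rw [hx, hx']
  set E := K * Real.exp (-(8 / 10 * (p * decayRate p) * (r - r / 10) / ε)) with hE
  have hone : ∀ i, ENNReal.ofReal ((1 - E) * transitionEnergy p)
      ≤ energy p ε (h i - r) (h i + r) U (deriv U) := by
    intro i
    obtain ⟨τ, hτ, hvl, hvr⟩ := hv.exists_sign hr hsep hleft hright i
    have hτ' : -τ = -1 ∨ -τ = 1 := by rcases hτ with rfl | rfl <;> norm_num
    obtain ⟨x₁, hx₁, hx₁τ⟩ := exists_mem_Ioo_abs_sub_lt (c := h i - r / 10) (d := h i) (η := η)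
      (by linarith [hleft i]) (by linarith) (by linarith [hright i]) hη
      (fun x hx => hvl x ⟨by linarith [hx.1], hx.2⟩) hc hL (by rwa [sub_sub_cancel])
    obtain ⟨x₂, hx₂, hx₂τ⟩ := exists_mem_Ioo_abs_sub_lt (c := h i) (d := h i + r / 10) (η := η)
      (by linarith [hleft i]) (by linarith) (by linarith [hright i]) hη
      (fun x hx => hvr x ⟨hx.1, by linarith [hx.2]⟩) hc hL (by rwa [add_sub_cancel_left])
    refine hlayer ε (h i) r (r / 10) x₁ x₂ τ U hε (by linarith) (hUac.mono ?_) hτ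
      (Ioo_subset_Icc_self hx₁) (Ioo_subset_Icc_self hx₂) (hclose _ hτ' _ hx₁τ)
      (hclose _ hτ _ hx₂τ) hTε
    rw [uIcc_of_le (by linarith), uIcc_of_le hab.le]
    exact Icc_subset_Icc (hleft i) (hright i)
  have hsum := (Finset.sum_le_sum fun i (_ : i ∈ Finset.univ) => hone i).trans
    (sum_energy_le hsep hleft hright U (deriv U))
  rw [hEeq, Finset.sum_const, Finset.card_univ, Fintype.card_fin, nsmul_eq_mul,
    ← ENNReal.ofReal_natCast, ← ENNReal.ofReal_mul (Nat.cast_nonneg N)] at hsum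
  have hEle : E ≤ K * Real.exp (-(A * p) / (2 * ε)) := by
    have : -(8 / 10 * (p * decayRate p) * (r - r / 10) / ε) ≤ -(A * p) / (2 * ε) := by
      rw [neg_div, neg_le_neg_iff, ← div_div]
      gcongr
    rw [hE]
    gcongr
  have hreal : N * transitionEnergy p
      - (N * transitionEnergy p * K + 1) * Real.exp (-(A * p) / (2 * ε))
      ≤ N * ((1 - E) * transitionEnergy p) := by
    have h1 := mul_le_mul_of_nonneg_left hEle
      (mul_nonneg (Nat.cast_nonneg (α := ℝ) N) hcp)
    have h2 := Real.exp_pos (-(A * p) / (2 * ε))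
    linarith
  calc ((N * transitionEnergy p
        - (N * transitionEnergy p * K + 1) * Real.exp (-(A * p) / (2 * ε)) : ℝ) : EReal)
      ≤ ((N * ((1 - E) * transitionEnergy p) : ℝ) : EReal) := EReal.coe_le_coe_iff.2 hreal
    _ ≤ (ENNReal.ofReal (N * ((1 - E) * transitionEnergy p)) : EReal) := by
        rw [EReal.coe_ennreal_ofReal]
        exact EReal.coe_le_coe_iff.2 (le_max_left _ _)
    _ ≤ (energy p ε a b u g : EReal) := EReal.coe_ennreal_le_coe_ennreal_iff.2 hsum
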